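/- Let $K$ be a field. For a finite simple graph $G$ with vertex set $V$, let $R=K[x_v : v\in V]$, let $I(G)=(x_ux_v : \{u,v\}\in E(G))$ be its edge ideal, let $\Delta_G$ be its independence complex (the simplicial complex of independent sets of $G$), and let $K[\Delta_G]=R/I_{\Delta_G}=R/I(G)$ be the Stanley–Reisner ring, where $I_{\Delta_G}$ is generated by the monomials $\prod_{v\in F}x_v$ with $F\notin\Delta_G$. Write $\operatorname{pdim}K[\Delta_G]$ for its projective dimension over $R$. A graph is chordal if it has no induced cycle of length at least $4$, and $G$ is co-chordal if its complement is chordal. One says that $I(G)$ has a $2$-linear resolution if $R/I(G)$ has a graded free resolution of the form $$0\to R(-2-p)^{\beta_p}\to\cdots\to R(-3)^{\beta_1}\to R(-2)^{\beta_0}\to R\to R/I(G)\to 0.$$ The Eliahou–Villarreal conjecture states that if $G$ is connected and $I(G)$ has a $2$-linear resolution, then $\operatorname{pdim}R/I(G)$ equals the maximum degree of $G$; it is also stated with "$G$ is co-chordal" in place of "$I(G)$ has a $2$-linear resolution". (1) Let $r\ge 3$, and let $G$ be the complement of the $r$-barbell, the graph on $2r$ vertices obtained from two disjoint copies of the complete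 graph $K_r$ by adding one edge between a vertex of the first copy and a vertex of the second. Then $G$ is connected and co-chordal, $I(G)$ has a $2$-linear resolution, the maximum degree of $G$ is $r$, and $\operatorname{pdim}K[\Delta_G]=2r-2$. Hence $\operatorname{pdim}K[\Delta_G]$ exceeds the maximum degree of $G$ by exactly $r-2$. (2) Consequently, the difference between $\operatorname{pdim}K[\Delta_G]$ and the maximum degree of $G$ is unbounded on the class of connected co-chordal graphs $G$ for which $I(G)$ has a $2$-linear resolution. (3) In particular, the Eliahou–Villarreal conjecture is false over every field $K$, in both of its forms. -/

import Mathlib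

namespace BarbellCounterexample

section Graphs

variable {V : Type*}

/-- A graph is chordal if it has no induced cycle of length at least four. -/
def IsChordal (G : SimpleGraph V) : Prop :=
  ∀ k : ℕ, 4 ≤ k → ¬ (SimpleGraph.cycleGraph k).IsIndContained G

/-- A graph is co-chordal if its complement is chordal. -/
def IsCoChordal (G : SimpleGraph V) : Prop := IsChordal Gᶜ

open scoped Classical in
/-- The maximum of the vertex degrees of a finite graph. -/
noncomputable def maxDeg [Fintype V] (G : SimpleGraph V) : ℕ := G.maxDegree

/-- The `r`-barbell: two disjoint copies of the complete graph on `r` vertices, joined by a bridge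
from the vertex `a` of the first copy to the vertex `b` of the second one. (Up to isomorphism,
the choice of `a` and `b` does not matter.) -/
def barbell {r : ℕ} (a b : Fin r) : SimpleGraph (Fin r ⊕ Fin r) :=
  SimpleGraph.sum (⊤ : SimpleGraph (Fin r)) (⊤ : SimpleGraph (Fin r)) ⊔
    SimpleGraph.edge (Sum.inl a) (Sum.inr b)

/-- The independence complex `Δ_G`: its faces are the independent sets of `G`. (Mathlib's abstract
simplicial complexes do not list the empty face.) -/
def independenceComplex (G : SimpleGraph V) : AbstractSimplicialComplex V where
  faces := {F | F.Nonempty ∧ G.IsIndepSet (F : Set V)}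
  isRelLowerSet_faces := by
    rintro F ⟨hF, hi⟩
    exact ⟨hF, fun H hHF hH => ⟨hH, hi.mono (by exact_mod_cast hHF)⟩⟩
  singleton_mem v := ⟨Finset.singleton_nonempty v, by simp⟩

end Graphs

section Algebra

open MvPolynomial

variable (K : Type*) [Field K] {V : Type*}

/-- The Stanley-Reisner ideal of a simplicial complex, generated by the squarefree monomials
`x_F` with `F` not a face (the empty set always counts as a face). -/
noncomputable def stanleyReisnerIdeal (Δ : AbstractSimplicialComplex V) : Ideal (MvPolynomial V K) :=
  Ideal.span {m | ∃ F : Finset V, F.Nonempty ∧ F ∉ Δ ∧ m = ∏ v ∈ F, X v}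

/-- The edge ideal of a graph, generated by the products `x_u x_v` over the edges `{u, v}`. -/
noncomputable def edgeIdeal (G : SimpleGraph V) : Ideal (MvPolynomial V K) :=
  Ideal.span {m | ∃ u v : V, G.Adj u v ∧ m = X u * X v}

/-- The projective dimension of `R / I` as a module over the polynomial ring `R`. -/
noncomputable def pdimQuotient (I : Ideal (MvPolynomial V K)) : WithBot ℕ∞ :=
  CategoryTheory.projectiveDimension (ModuleCat.of (MvPolynomial V K) (MvPolynomial V K ⧸ I))

/-- The projective dimension of the Stanley-Reisner ring `K[Δ] = R / I_Δ` over `R`. -/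
noncomputable def pdimStanleyReisner (Δ : AbstractSimplicialComplex V) : WithBot ℕ∞ :=
  pdimQuotient K (stanleyReisnerIdeal K Δ)

variable {K} in
/-- The ideal `I` has a 2-linear resolution: there is a graded free resolution
`0 → R(-2-p)^(b p) → ⋯ → R(-3)^(b 1) → R(-2)^(b 0) → R → R / I → 0`.
The first map is given by a row `g` of quadratic forms generating `I`. The other maps are given by
matrices `d i` of linear forms: this is what it means for a map
`R(-3-i)^(b (i+1)) → R(-2-i)^(b i)` to be homogeneous of degree zero. Since all the entries lie in
the irrelevant ideal, such a resolution is minimal. -/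
def HasTwoLinearResolution (I : Ideal (MvPolynomial V K)) : Prop :=
  ∃ (p : ℕ) (b : ℕ → ℕ) (g : Fin (b 0) → MvPolynomial V K)
    (d : ∀ i : ℕ, Matrix (Fin (b i)) (Fin (b (i + 1))) (MvPolynomial V K)),
    (∀ i, p < i → b i = 0) ∧
    (∀ j, (g j).IsHomogeneous 2) ∧
    (∀ i j k, (d i j k).IsHomogeneous 1) ∧
    Ideal.span (Set.range g) = I ∧
    Function.Exact (d 0).mulVecLin (Fintype.linearCombination (MvPolynomial V K) g) ∧
    ∀ i, Function.Exact (d (i + 1)).mulVecLin (d i).mulVecLin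

/-- The Eliahou-Villarreal conjecture over the field `K`: if the edge ideal of a connected finite
graph `G` has a 2-linear resolution, then the projective dimension of `R / I(G)` is the maximum
degree of the vertices of `G`. -/
def EliahouVillarrealConjecture : Prop :=
  ∀ (V : Type) [Fintype V] (G : SimpleGraph V), G.Connected →
    HasTwoLinearResolution (edgeIdeal K G) → pdimQuotient K (edgeIdeal K G) = (maxDeg G : ℕ)

/-- The form of the Eliahou-Villarreal conjecture for co-chordal graphs: if a connected finite
graph `G` is co-chordal, then the projective dimension of `K[Δ_G]` is the maximum degree. -/
def EliahouVillarrealConjectureCoChordal : Prop :=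
  ∀ (V : Type) [Fintype V] (G : SimpleGraph V), G.Connected → IsCoChordal G →
    pdimStanleyReisner K (independenceComplex G) = (maxDeg G : ℕ)

/-- The Stanley-Reisner ideal of the independence complex of `G` is the edge ideal of `G`. -/
theorem stanleyReisnerIdeal_independenceComplex (G : SimpleGraph V) :
    stanleyReisnerIdeal K (independenceComplex G) = edgeIdeal K G := by
  classical
  apply le_antisymm
  · refine Ideal.span_le.2 ?_
    rintro _ ⟨F, hF, hn, rfl⟩
    have hi : ¬ G.IsIndepSet (F : Set V) := fun h => hn ⟨hF, h⟩
    simp only [SimpleGraph.IsIndepSet, Set.Pairwise, not_forall, not_not] at hi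
    obtain ⟨u, hu, v, hv, huv, hadj⟩ := hi
    have hsub : ({u, v} : Finset V) ⊆ F := by
      intro w hw
      simp only [Finset.mem_insert, Finset.mem_singleton] at hw
      rcases hw with rfl | rfl <;> assumption
    refine Ideal.mem_of_dvd _ ?_ (Ideal.subset_span ⟨u, v, hadj, rfl⟩)
    rw [← Finset.prod_pair huv]
    exact Finset.prod_dvd_prod_of_subset _ _ _ hsub
  · refine Ideal.span_le.2 ?_
    rintro _ ⟨u, v, hadj, rfl⟩
    refine Ideal.subset_span ⟨{u, v}, by simp, ?_, (Finset.prod_pair hadj.ne).symm⟩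
    rintro ⟨-, h⟩
    exact h (by simp) (by simp) hadj.ne hadj

end Algebra

end BarbellCounterexample

/-! The complement of the `r`-barbell is the complete bipartite graph `K_{r,r}` with the edge `ab`
deleted. This is a Ferrers graph: every row is full except row `a`, which lacks `b`. Adding the
generators `x_i y_j` row by row, with row `a` last, gives linear quotients: each new generator has
as colon ideal the ideal of the variables of the finished rows and of the columns already used in
the current row (`mul_mem_pairIdeal_ferrersEdges`).

A linear colon ideal extends a linear resolution to a linear resolution
(`HasLinRes.sup_span_singleton`, by the horseshoe lemma `LinRes.fromBlocks`). No colon ideal needs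
more than `2r - 3` variables, and the last one has exactly `(r - 1) + (r - 2)`; its Koszul
resolution makes the last free module nonzero. A resolution by linear forms cannot split at its end
(`not_projective_range`), so its length `2r - 2` is the projective dimension of `R/I(G)`. The
maximum degree is only `r`, attained at any vertex other than `a` and `b`. -/

namespace BarbellCounterexample

open MvPolynomial Matrix

/-! ### Linear resolutions by matrices, the horseshoe construction and linear quotients. -/

section LinearResolutions

universe u

variable {K : Type u} [Field K] {σ : Type}

/-- The columns of the matrix `A` have a resolution of length at most `n` by matrices of linear
forms; if `t` holds, then the last free module of the resolution is nonzero. -/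
def LinRes (t : Prop) : ℕ → ∀ {ι κ : Type} [Fintype κ], Matrix ι κ (MvPolynomial σ K) → Prop
  | 0, _, κ, _, A => Function.Injective A.mulVecLin ∧ (t → Nonempty κ)
  | n + 1, _, κ, _, A => ∃ (μ : Type) (_ : Fintype μ) (D : Matrix κ μ (MvPolynomial σ K)),
      (∀ i j, (D i j).IsHomogeneous 1) ∧ Function.Exact D.mulVecLin A.mulVecLin ∧ LinRes t n D

theorem LinRes.weaken {t s : Prop} (hst : s → t) {n : ℕ} {ι κ : Type} [Fintype κ]
    {A : Matrix ι κ (MvPolynomial σ K)} (h : LinRes t n A) : LinRes s n A := by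
  induction n generalizing ι κ with
  | zero => exact ⟨h.1, fun hs => h.2 (hst hs)⟩
  | succ n ih =>
    obtain ⟨μ, _, D, hD, hE, hL⟩ := h
    exact ⟨μ, _, D, hD, hE, ih hL⟩

/-- A zero module is appended on the left, so the claim that the last module is nonzero is given up.
-/
theorem LinRes.succ {t : Prop} {n : ℕ} {ι κ : Type} [Fintype κ]
    {A : Matrix ι κ (MvPolynomial σ K)} (h : LinRes t n A) : LinRes False (n + 1) A := by
  induction n generalizing ι κ with
  | zero =>
    refine ⟨Empty, inferInstance, 0, fun i j => j.elim, ?_, fun x y _ => Subsingleton.elim x y,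
      False.elim⟩
    intro y
    constructor
    · intro hy
      exact ⟨0, by rw [map_zero, h.1 (hy.trans (map_zero _).symm)]⟩
    · rintro ⟨x, rfl⟩
      simp
  | succ n ih =>
    obtain ⟨μ, _, D, hD, hE, hL⟩ := h
    exact ⟨μ, _, D, hD, hE, ih hL⟩

theorem LinRes.of_le {t : Prop} {n m : ℕ} (hnm : n ≤ m) {ι κ : Type} [Fintype κ]
    {A : Matrix ι κ (MvPolynomial σ K)} (h : LinRes t n A) : LinRes False m A := by
  induction m, hnm using Nat.le_induction with
  | base => exact h.weaken False.elim
  | succ m _ ih => exact ih.succ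

theorem homogeneousComponent_mul_of_isHomogeneous {e k : ℕ} {a : MvPolynomial σ K}
    (ha : a.IsHomogeneous e) (w : MvPolynomial σ K) :
    homogeneousComponent (e + k) (a * w) = a * homogeneousComponent k w := by
  conv_lhs => rw [← sum_homogeneousComponent w, Finset.mul_sum, map_sum]
  rw [Finset.sum_eq_single k]
  · exact homogeneousComponent_eq_self (ha.mul (homogeneousComponent_isHomogeneous k w))
  · intro i _ hi
    rw [homogeneousComponent_of_mem (ha.mul (homogeneousComponent_isHomogeneous i w)),
      if_neg (by omega)]
  · intro hk
    rw [homogeneousComponent_eq_zero k w (by simpa using hk), mul_zero, map_zero]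

/-- A system of equations between forms of degree `e` and `e + 1` that has a solution
has a solution in linear forms. -/
theorem exists_linear_solution {ι κ : Type} [Fintype κ] {e : ℕ}
    {A : Matrix ι κ (MvPolynomial σ K)} (hA : ∀ i j, (A i j).IsHomogeneous e)
    {y : ι → MvPolynomial σ K} (hy : ∀ i, (y i).IsHomogeneous (e + 1))
    (h : ∃ w, A *ᵥ w = y) : ∃ w, (∀ k, (w k).IsHomogeneous 1) ∧ A *ᵥ w = y := by
  obtain ⟨w, hw⟩ := h
  -- As `A` has entries of degree `e`, the part of `A *ᵥ w` in degree `e + 1` depends only on the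
  -- linear part of `w`.
  refine ⟨fun k => homogeneousComponent 1 (w k),
    fun k => homogeneousComponent_isHomogeneous _ _, ?_⟩
  funext i
  rw [← homogeneousComponent_eq_self (hy i), ← hw]
  simp only [mulVec, dotProduct, map_sum]
  exact Finset.sum_congr rfl fun k _ => (homogeneousComponent_mul_of_isHomogeneous (hA i k) _).symm

/-- Solving column by column gives the corner block of the next map in a horseshoe; the sign makes
the row `(A C)` vanish on the column with blocks `L` and `E`. -/
theorem exists_linear_lift {ι κ κ' μ : Type} [Fintype κ] [Fintype κ'] [Fintype μ] {e : ℕ}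
    {A : Matrix ι κ (MvPolynomial σ K)} {C : Matrix ι κ' (MvPolynomial σ K)}
    {E : Matrix κ' μ (MvPolynomial σ K)}
    (hA : ∀ i j, (A i j).IsHomogeneous e) (hC : ∀ i j, (C i j).IsHomogeneous e)
    (hE : ∀ i j, (E i j).IsHomogeneous 1)
    (h : ∀ u, ∃ w, A *ᵥ w = C *ᵥ (E *ᵥ u)) :
    ∃ L : Matrix κ μ (MvPolynomial σ K), (∀ i j, (L i j).IsHomogeneous 1) ∧
      ∀ u, A *ᵥ (L *ᵥ u) = -(C *ᵥ (E *ᵥ u)) := by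
  classical
  have key : ∀ j : μ, ∃ w : κ → MvPolynomial σ K, (∀ k, (w k).IsHomogeneous 1) ∧
      A *ᵥ w = fun i => -((C * E) i j) := by
    intro j
    apply exists_linear_solution hA
    · intro i
      rw [Matrix.mul_apply]
      exact (IsHomogeneous.sum _ _ _ fun k _ => (hC i k).mul (hE k j)).neg
    · obtain ⟨w, hw⟩ := h (Pi.single j 1)
      refine ⟨-w, ?_⟩
      rw [mulVec_neg, hw, mulVec_mulVec, mulVec_single_one]
      rfl
  choose w hw1 hw2 using key
  refine ⟨Matrix.of fun k j => w j k, fun k j => hw1 j k, fun u => ?_⟩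
  rw [mulVec_mulVec, mulVec_mulVec, ← neg_mulVec]
  congr 1
  ext1 i j
  exact congrFun (hw2 j) i

/-- The horseshoe lemma for linear resolutions. -/
theorem LinRes.fromBlocks {t t' : Prop} {n e : ℕ} {ι ι' κ κ' : Type} [Fintype κ] [Fintype κ']
    {A : Matrix ι κ (MvPolynomial σ K)} {C : Matrix ι κ' (MvPolynomial σ K)}
    {B : Matrix ι' κ' (MvPolynomial σ K)}
    (hA : ∀ i j, (A i j).IsHomogeneous e) (hC : ∀ i j, (C i j).IsHomogeneous e)
    (hAC : ∀ v, B *ᵥ v = 0 → ∃ w, A *ᵥ w = C *ᵥ v)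
    (hLA : LinRes t n A) (hLB : LinRes t' n B) :
    LinRes (t ∨ t') n (Matrix.fromBlocks A C 0 B) := by
  induction n generalizing e ι ι' κ κ' with
  | zero =>
    constructor
    · rw [← LinearMap.ker_eq_bot, LinearMap.ker_eq_bot']
      intro v hv
      rw [mulVecLin_apply, fromBlocks_mulVec] at hv
      have h1 := congrArg (· ∘ Sum.inl) hv
      have h2 := congrArg (· ∘ Sum.inr) hv
      simp only [Sum.elim_comp_inl, Sum.elim_comp_inr, zero_mulVec, zero_add] at h1 h2
      have h3 : v ∘ Sum.inr = 0 := hLB.1 (h2.trans (map_zero B.mulVecLin).symm)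
      rw [h3, mulVec_zero, add_zero] at h1
      have h4 : v ∘ Sum.inl = 0 := hLA.1 (h1.trans (map_zero A.mulVecLin).symm)
      funext k
      cases k with
      | inl k => exact congrFun h4 k
      | inr k => exact congrFun h3 k
    · rintro (h | h)
      · exact (hLA.2 h).map Sum.inl
      · exact (hLB.2 h).map Sum.inr
  | succ n ih =>
    obtain ⟨μ, _, D, hD, hDA, hL⟩ := hLA
    obtain ⟨μ', _, E, hE, hEB, hL'⟩ := hLB
    obtain ⟨L, hLh, hLA⟩ := exists_linear_lift hA hC hE
      fun u => hAC _ (hEB.apply_apply_eq_zero u)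
    refine ⟨μ ⊕ μ', inferInstance, Matrix.fromBlocks D L 0 E, ?_, ?_, ih hD hLh ?_ hL hL'⟩
    · rintro (i | i) (j | j)
      · exact hD i j
      · exact hLh i j
      · exact isHomogeneous_zero _ _ _
      · exact hE i j
    · intro y
      rw [mulVecLin_apply, fromBlocks_mulVec]
      constructor
      · intro hv
        have h1 := congrArg (· ∘ Sum.inl) hv
        have h2 := congrArg (· ∘ Sum.inr) hv
        simp only [Sum.elim_comp_inl, Sum.elim_comp_inr, zero_mulVec, zero_add] at h1 h2
        -- The lower half of a syzygy comes from `E`; correcting the upper half by `L *ᵥ u` leaves a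
        -- syzygy of `A`.
        obtain ⟨u, hu⟩ := (hEB _).1 h2
        rw [mulVecLin_apply] at hu
        have h3 : A *ᵥ (y ∘ Sum.inl - L *ᵥ u) = 0 := by
          rw [mulVec_sub, hLA, sub_neg_eq_add, hu]
          exact h1
        obtain ⟨x, hx⟩ := (hDA _).1 h3
        rw [mulVecLin_apply] at hx
        refine ⟨Sum.elim x u, ?_⟩
        rw [mulVecLin_apply, fromBlocks_mulVec, Sum.elim_comp_inl, Sum.elim_comp_inr, hx, hu,
          zero_mulVec, zero_add, sub_add_cancel, Sum.elim_comp_inl_inr]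
      · rintro ⟨x, rfl⟩
        rw [mulVecLin_apply, fromBlocks_mulVec, Sum.elim_comp_inl, Sum.elim_comp_inr]
        have h1 := hDA.apply_apply_eq_zero (x ∘ Sum.inl)
        have h2 := hEB.apply_apply_eq_zero (x ∘ Sum.inr)
        simp only [mulVecLin_apply] at h1 h2
        simp only [zero_mulVec, zero_add, mulVec_add, h1, h2, hLA, neg_add_cancel]
        funext k
        cases k <;> rfl
    -- The lifting hypothesis passes to the next stage: on the kernel of `E`, the values of `L` are
    -- syzygies of `A`.
    · intro v hv
      obtain ⟨x, hx⟩ := (hDA (L *ᵥ v)).1 (by rw [mulVecLin_apply, hLA, hv, mulVec_zero, neg_zero])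
      exact ⟨x, hx⟩

/-- The ideal `J` has a generating row of forms of degree `e` whose syzygies have a linear
resolution of length at most `n`, of length exactly `n` if `t` holds. -/
def HasLinRes (t : Prop) (n e : ℕ) (J : Ideal (MvPolynomial σ K)) : Prop :=
  ∃ (κ : Type) (_ : Fintype κ) (A : Matrix Unit κ (MvPolynomial σ K)),
    (∀ i j, (A i j).IsHomogeneous e) ∧ (∀ h, h ∈ J ↔ ∃ v, A *ᵥ v = fun _ => h) ∧ LinRes t n A

theorem HasLinRes.of_le {t : Prop} {n m e : ℕ} {J : Ideal (MvPolynomial σ K)} (hnm : n ≤ m)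
    (h : HasLinRes t n e J) : HasLinRes False m e J := by
  obtain ⟨κ, _, A, hA, hJ, hL⟩ := h
  exact ⟨κ, _, A, hA, hJ, hL.of_le hnm⟩

theorem HasLinRes.weaken {t s : Prop} (hst : s → t) {n e : ℕ} {J : Ideal (MvPolynomial σ K)}
    (h : HasLinRes t n e J) : HasLinRes s n e J := by
  obtain ⟨κ, _, A, hA, hJ, hL⟩ := h
  exact ⟨κ, _, A, hA, hJ, hL.weaken hst⟩

theorem hasLinRes_bot (n e : ℕ) : HasLinRes False n e (⊥ : Ideal (MvPolynomial σ K)) := by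
  refine ⟨Empty, inferInstance, 0, fun _ j => j.elim, fun h => ?_,
    LinRes.of_le (t := False) (Nat.zero_le n) ⟨fun x y _ => Subsingleton.elim x y, False.elim⟩⟩
  simp only [Submodule.mem_bot, zero_mulVec]
  constructor
  · rintro rfl
    exact ⟨0, rfl⟩
  · rintro ⟨_, h⟩
    exact (congrFun h ()).symm

theorem hasLinRes_span_singleton {f : MvPolynomial σ K} (hf : f ≠ 0) {e : ℕ}
    (he : f.IsHomogeneous e) : HasLinRes True 0 e (Ideal.span {f}) := by
  have hv : ∀ v : Unit → MvPolynomial σ K,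
      (Matrix.of fun _ _ => f : Matrix Unit Unit (MvPolynomial σ K)) *ᵥ v = fun _ => f * v () := by
    intro v
    funext i
    simp [mulVec, dotProduct]
  refine ⟨Unit, inferInstance, Matrix.of fun _ _ => f, fun _ _ => he, fun h => ?_, ?_,
    fun _ => inferInstance⟩
  · rw [Ideal.mem_span_singleton]
    constructor
    · rintro ⟨c, rfl⟩
      exact ⟨fun _ => c, hv _⟩
    · rintro ⟨v, h⟩
      rw [hv] at h
      exact ⟨v (), (congrFun h ()).symm⟩
  · intro x y hxy
    rw [mulVecLin_apply, mulVecLin_apply, hv, hv] at hxy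
    funext i
    exact mul_left_cancel₀ hf (congrFun hxy ())

/-- Linear quotients: adding a generator with a linear colon ideal. -/
theorem HasLinRes.sup_span_singleton {t t' : Prop} {m e : ℕ} {J L : Ideal (MvPolynomial σ K)}
    {f : MvPolynomial σ K} (he : f.IsHomogeneous e) (hcolon : ∀ h, h * f ∈ J ↔ h ∈ L)
    (hJ : HasLinRes t (m + 1) e J) (hL : HasLinRes t' m 1 L) :
    HasLinRes (t ∨ t') (m + 1) e (J ⊔ Ideal.span {f}) := by
  obtain ⟨κ, _, A, hA, hAJ, μ, _, D, hD, hDA, hLD⟩ := hJ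
  obtain ⟨ν, _, E, hE, hEL, hLE⟩ := hL
  set C : Matrix Unit Unit (MvPolynomial σ K) := Matrix.of fun _ _ => f with hC
  have hCv : ∀ v : Unit → MvPolynomial σ K, C *ᵥ v = fun _ => v () * f := by
    intro v
    funext i
    simp [hC, mulVec, dotProduct, mul_comm]
  -- Elements of `L` multiply `f` into `J`, so `C` after `E` factors through the generators of `J`.
  obtain ⟨M, hM, hMA⟩ := exists_linear_lift (C := C) hA (fun _ _ => he) hE (by
    intro u
    rw [hCv, ← hAJ, hcolon, hEL]
    exact ⟨u, rfl⟩)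
  have hcols : ∀ v : κ ⊕ Unit → MvPolynomial σ K,
      Matrix.fromCols A C *ᵥ v = A *ᵥ (v ∘ Sum.inl) + C *ᵥ (v ∘ Sum.inr) :=
    fun v => fromCols_mulVec A C v
  refine ⟨κ ⊕ Unit, inferInstance, Matrix.fromCols A C, ?_, ?_, μ ⊕ ν, inferInstance,
    Matrix.fromBlocks D M 0 E, ?_, ?_, LinRes.fromBlocks hD hM ?_ hLD hLE⟩
  · rintro i (j | j)
    · exact hA i j
    · exact he
  · intro h
    rw [Submodule.mem_sup]
    constructor
    · rintro ⟨y, hy, z, hz, rfl⟩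
      obtain ⟨v, hv⟩ := (hAJ y).1 hy
      obtain ⟨c, rfl⟩ := Ideal.mem_span_singleton'.1 hz
      refine ⟨Sum.elim v fun _ => c, ?_⟩
      rw [hcols, Sum.elim_comp_inl, Sum.elim_comp_inr, hCv, hv]
      rfl
    · rintro ⟨v, hv⟩
      rw [hcols, hCv] at hv
      refine ⟨(A *ᵥ (v ∘ Sum.inl)) (), (hAJ _).2 ⟨v ∘ Sum.inl, rfl⟩, v (Sum.inr ()) * f,
        Ideal.mem_span_singleton'.2 ⟨_, rfl⟩, congrFun hv ()⟩
  · rintro (i | i) (j | j)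
    · exact hD i j
    · exact hM i j
    · exact isHomogeneous_zero _ _ _
    · exact hE i j
  · intro y
    rw [mulVecLin_apply, hcols]
    constructor
    · intro hv
      -- In a relation on the enlarged generating row, the coefficient of `f` lies in the colon
      -- ideal, hence in the image of `E`.
      have h0 : y (Sum.inr ()) * f ∈ J := by
        rw [hAJ]
        refine ⟨-(y ∘ Sum.inl), ?_⟩
        rw [mulVec_neg, eq_neg_of_add_eq_zero_left hv, hCv, neg_neg]
        rfl
      obtain ⟨u, hu⟩ := (hEL _).1 ((hcolon _).1 h0)
      have hu' : E *ᵥ u = y ∘ Sum.inr := hu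
      have h3 : A *ᵥ (y ∘ Sum.inl - M *ᵥ u) = 0 := by
        rw [mulVec_sub, hMA, sub_neg_eq_add, hu', hv]
      obtain ⟨x, hx⟩ := (hDA _).1 h3
      rw [mulVecLin_apply] at hx
      refine ⟨Sum.elim x u, ?_⟩
      rw [mulVecLin_apply, fromBlocks_mulVec, Sum.elim_comp_inl, Sum.elim_comp_inr, hx, hu',
        zero_mulVec, zero_add, sub_add_cancel, Sum.elim_comp_inl_inr]
    · rintro ⟨x, rfl⟩
      rw [mulVecLin_apply, fromBlocks_mulVec, Sum.elim_comp_inl, Sum.elim_comp_inr]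
      have h1 := hDA.apply_apply_eq_zero (x ∘ Sum.inl)
      simp only [mulVecLin_apply] at h1
      simp only [zero_mulVec, zero_add, mulVec_add, h1, hMA, neg_add_cancel]
  · intro v hv
    obtain ⟨x, hx⟩ := (hDA (M *ᵥ v)).1 (by rw [mulVecLin_apply, hMA, hv, mulVec_zero, neg_zero])
    exact ⟨x, hx⟩

/-- Unrolls the recursive resolution into an `ℕ`-indexed one: finite index types are numbered by
`Fin`, and zero modules fill the positions beyond `n`. -/
theorem LinRes.exists_sequence {t : Prop} {n : ℕ} {ι κ : Type} [Fintype κ]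
    {A : Matrix ι κ (MvPolynomial σ K)} (h : LinRes t n A) :
    ∃ (b : ℕ → ℕ) (d : ∀ i : ℕ, Matrix (Fin (b i)) (Fin (b (i + 1))) (MvPolynomial σ K))
      (ε : Fin (b 0) ≃ κ),
      (∀ i, n < i → b i = 0) ∧ (∀ i j k, (d i j k).IsHomogeneous 1) ∧
      Function.Exact (d 0).mulVecLin (A.submatrix id ε).mulVecLin ∧
      ∀ i, Function.Exact (d (i + 1)).mulVecLin (d i).mulVecLin := by
  have hsub : ∀ {ι ι' κ κ' : Type} [Fintype κ] [Fintype κ'] (A : Matrix ι κ (MvPolynomial σ K))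
      (f : ι' → ι) (ε : κ' ≃ κ) (v), (A.submatrix f ε).mulVecLin v =
        (A.mulVecLin (v ∘ ε.symm)) ∘ f :=
    fun A f ε v => submatrix_mulVec_equiv A v f ε
  induction n generalizing ι κ with
  | zero =>
    refine ⟨fun | 0 => Fintype.card κ | _ + 1 => 0, fun _ => 0, (Fintype.equivFin κ).symm,
      ?_, fun i j k => isHomogeneous_zero _ _ _, ?_, ?_⟩
    · rintro (_ | i) hi
      · omega
      · rfl
    · intro y
      constructor
      · intro hy
        rw [hsub] at hy
        have h1 := h.1 (hy.trans (map_zero A.mulVecLin).symm)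
        refine ⟨0, ?_⟩
        rw [map_zero]
        funext i
        have := congrFun h1 ((Fintype.equivFin κ).symm i)
        simpa using this.symm
      · rintro ⟨x, rfl⟩
        simp
    · intro i y
      exact ⟨fun _ => ⟨0, funext fun j => Fin.elim0 j⟩, by rintro ⟨x, rfl⟩; simp⟩
  | succ n ih =>
    obtain ⟨μ, _, D, hD, hE, hL⟩ := h
    obtain ⟨b, d, ε, hb, hd, hd0, hds⟩ := ih hL
    set ε₀ := (Fintype.equivFin κ).symm
    refine ⟨fun | 0 => Fintype.card κ | i + 1 => b i,
      fun | 0 => D.submatrix ε₀ ε | i + 1 => d i, ε₀, ?_, ?_, ?_, ?_⟩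
    · rintro (_ | i) hi
      · omega
      · exact hb i (by omega)
    · rintro (_ | i) j k
      · exact hD _ _
      · exact hd i j k
    · intro y
      rw [hsub]
      constructor
      · intro hy
        obtain ⟨x, hx⟩ := (hE _).1 hy
        refine ⟨x ∘ ε, ?_⟩
        refine (hsub _ _ _ _).trans ?_
        rw [Function.comp_assoc, Equiv.self_comp_symm, Function.comp_id, hx, Function.comp_assoc,
          Equiv.symm_comp_self, Function.comp_id]
      · rintro ⟨x, rfl⟩
        have : (D.submatrix ε₀ ε).mulVecLin x ∘ ε₀.symm = D.mulVecLin (x ∘ ε.symm) := by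
          rw [hsub, Function.comp_assoc, Equiv.self_comp_symm, Function.comp_id]
        exact (congrArg _ this).trans (hE.apply_apply_eq_zero _)
    · rintro (_ | i)
      · intro y
        refine Iff.trans ?_ (hd0 y)
        refine (Eq.congr_left (hsub D ε₀ ε y)).trans ?_
        rw [hsub D id ε y, Function.comp_id]
        constructor
        · intro h
          funext k
          have := congrFun h (ε₀.symm k)
          simpa using this
        · intro h
          rw [h]
          rfl
      · exact hds i

theorem HasLinRes.hasTwoLinearResolution {t : Prop} {n : ℕ} {J : Ideal (MvPolynomial σ K)}
    (h : HasLinRes t n 2 J) : HasTwoLinearResolution J := by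
  obtain ⟨κ, _, A, hA, hJ, hL⟩ := h
  obtain ⟨b, d, ε, hb, hd, hd0, hds⟩ := hL.exists_sequence
  refine ⟨n, b, fun j => A () (ε j), d, hb, fun j => hA _ _, hd, ?_, ?_, hds⟩
  · ext h
    rw [hJ, Ideal.mem_span_range_iff_exists_fun]
    constructor
    · rintro ⟨c, rfl⟩
      refine ⟨c ∘ ε.symm, funext fun i => ?_⟩
      simp only [mulVec, dotProduct, Function.comp]
      rw [← ε.sum_comp]
      simp [mul_comm]
    · rintro ⟨v, hv⟩
      refine ⟨v ∘ ε, ?_⟩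
      rw [← congrFun hv ()]
      simp only [mulVec, dotProduct, Function.comp]
      rw [← ε.sum_comp]
      simp [mul_comm]
  · intro y
    rw [← hd0 y, funext_iff, Unique.forall_iff]
    simp [mulVec, dotProduct, Fintype.linearCombination_apply, mul_comm]

end LinearResolutions

end BarbellCounterexample
namespace BarbellCounterexample

open MvPolynomial Matrix

/-! ### From linear resolutions to exact values of the projective dimension. -/

section ProjectiveDimension

universe u

open CategoryTheory

section

variable {R M N P : Type u} [CommRing R] [AddCommGroup M] [Module R M] [AddCommGroup N] [Module R N]
  [AddCommGroup P] [Module R P] {f : M →ₗ[R] N} {g : N →ₗ[R] P}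

/-- Dimension shifting along a short exact sequence with projective middle term; it peels one free
module off a resolution. -/
theorem hasProjectiveDimensionLT_right_iff [Module.Projective R N] (hf : Function.Injective f)
    (hfg : Function.Exact f g) (hg : Function.Surjective g) (n : ℕ) :
    HasProjectiveDimensionLT (ModuleCat.of R P) (n + 2) ↔
      HasProjectiveDimensionLT (ModuleCat.of R M) (n + 1) := by
  let S : ShortComplex (ModuleCat.{u} R) :=
    ShortComplex.mk (ModuleCat.ofHom f) (ModuleCat.ofHom g) (by
      ext x
      exact hfg.apply_apply_eq_zero x)
  have hS : S.ShortExact := ModuleCat.shortComplex_shortExact S hfg hf hg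
  exact hS.hasProjectiveDimensionLT_X₃_iff n
    ((IsProjective.iff_projective (ModuleCat.of R N)).1 inferInstance)

theorem module_projective_iff_hasProjectiveDimensionLT_one :
    Module.Projective R M ↔ HasProjectiveDimensionLT (ModuleCat.of R M) 1 :=
  (IsProjective.iff_projective (ModuleCat.of R M)).trans
    projective_iff_hasProjectiveDimensionLT_one

end

variable {K : Type u} [Field K] {σ : Type}

theorem exact_subtype_rangeRestrict {ι κ μ : Type} [Fintype κ] [Fintype μ]
    {A : Matrix ι κ (MvPolynomial σ K)} {D : Matrix κ μ (MvPolynomial σ K)}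
    (hE : Function.Exact D.mulVecLin A.mulVecLin) :
    Function.Exact (LinearMap.range D.mulVecLin).subtype A.mulVecLin.rangeRestrict := fun y =>
  (Subtype.ext_iff.trans (hE y)).trans (by simp)

theorem LinRes.hasProjectiveDimensionLE {t : Prop} {n : ℕ} {ι κ : Type} [Fintype κ]
    {A : Matrix ι κ (MvPolynomial σ K)} (h : LinRes t n A) :
    HasProjectiveDimensionLE (ModuleCat.of (MvPolynomial σ K) (LinearMap.range A.mulVecLin)) n := by
  induction n generalizing ι κ with
  | zero =>
    have : Module.Projective (MvPolynomial σ K) (LinearMap.range A.mulVecLin) :=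
      Module.Projective.of_equiv (LinearEquiv.ofInjective A.mulVecLin h.1)
    exact module_projective_iff_hasProjectiveDimensionLT_one.1 this
  | succ n ih =>
    obtain ⟨μ, _, D, hD, hE, hL⟩ := h
    refine (hasProjectiveDimensionLT_right_iff (f := (LinearMap.range D.mulVecLin).subtype)
      (g := A.mulVecLin.rangeRestrict) (Submodule.subtype_injective _)
      (exact_subtype_rangeRestrict hE) A.mulVecLin.surjective_rangeRestrict n).2 (ih hL)
/-- The cokernel of an injective matrix of linear forms with a column is not projective. -/
theorem not_projective_range {ι κ μ : Type} [Fintype κ] [Fintype μ] [Nonempty μ]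
    {A : Matrix ι κ (MvPolynomial σ K)} {D : Matrix κ μ (MvPolynomial σ K)}
    (hD : ∀ i j, (D i j).IsHomogeneous 1) (hE : Function.Exact D.mulVecLin A.mulVecLin)
    (hinj : Function.Injective D.mulVecLin) :
    ¬ Module.Projective (MvPolynomial σ K) (LinearMap.range A.mulVecLin) := by
  classical
  intro hP
  obtain ⟨s, hs⟩ := Module.projective_lifting_property A.mulVecLin.rangeRestrict LinearMap.id
    A.mulVecLin.surjective_rangeRestrict
  have hE' : Function.Exact D.mulVecLin A.mulVecLin.rangeRestrict :=
    fun y => Subtype.ext_iff.trans (hE y)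
  -- A section of the surjection onto the range of `A` yields a retraction of `D`.
  obtain ⟨l, hl⟩ : ∃ l, l ∘ₗ D.mulVecLin = LinearMap.id :=
    ((hE'.split_tfae hinj A.mulVecLin.surjective_rangeRestrict).out 0 1 :
      (∃ l, A.mulVecLin.rangeRestrict ∘ₗ l = LinearMap.id) ↔ _).1 ⟨s, hs⟩
  obtain ⟨j⟩ := ‹Nonempty μ›
  have h1 : l (D *ᵥ Pi.single j 1) = Pi.single j 1 := LinearMap.congr_fun hl (Pi.single j 1)
  rw [mulVec_single_one, pi_eq_sum_univ' (D.col j), map_sum] at h1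
  -- Modulo the irrelevant ideal `D` is zero, so the identity `l ∘ D = id` would read `0 = 1` there.
  have h2 := congrArg constantCoeff (congrFun h1 j)
  simp only [map_smul, Finset.sum_apply, Pi.smul_apply, smul_eq_mul, map_sum, map_mul,
    Pi.single_eq_same, map_one] at h2
  refine zero_ne_one ((Finset.sum_eq_zero fun i _ => ?_).symm.trans h2)
  rw [show constantCoeff (D.col j i) = 0 from ?_, zero_mul]
  rw [constantCoeff_eq]
  exact (hD i j).coeff_eq_zero (by simp)

/-- Dimension shifting reduces to the last map of the resolution, which is injective with nonzero
source and does not split. -/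
theorem LinRes.not_hasProjectiveDimensionLT {n : ℕ} {ι κ : Type} [Fintype κ]
    {A : Matrix ι κ (MvPolynomial σ K)} (h : LinRes True (n + 1) A) :
    ¬ HasProjectiveDimensionLT
      (ModuleCat.of (MvPolynomial σ K) (LinearMap.range A.mulVecLin)) (n + 1) := by
  induction n generalizing ι κ with
  | zero =>
    obtain ⟨μ, _, D, hD, hE, hinj, hne⟩ := h
    have := hne trivial
    intro hpd
    exact not_projective_range hD hE hinj 
      (module_projective_iff_hasProjectiveDimensionLT_one.2 hpd)
  | succ n ih =>
    obtain ⟨μ, _, D, hD, hE, hL⟩ := h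
    rw [hasProjectiveDimensionLT_right_iff (f := (LinearMap.range D.mulVecLin).subtype)
      (g := A.mulVecLin.rangeRestrict) (Submodule.subtype_injective _)
      (exact_subtype_rangeRestrict hE) A.mulVecLin.surjective_rangeRestrict n]
    exact ih hL
theorem HasLinRes.pdimQuotient_eq {n e : ℕ} {J : Ideal (MvPolynomial σ K)}
    (h : HasLinRes True (n + 1) e J) : pdimQuotient K J = ((n + 2 : ℕ) : WithBot ℕ∞) := by
  obtain ⟨κ, _, A, hA, hJ, hL⟩ := h
  have hiff : ∀ m, HasProjectiveDimensionLT
      (ModuleCat.of (MvPolynomial σ K) (MvPolynomial σ K ⧸ J)) (m + 2) ↔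
      HasProjectiveDimensionLT
      (ModuleCat.of (MvPolynomial σ K) (LinearMap.range A.mulVecLin)) (m + 1) := by
    refine hasProjectiveDimensionLT_right_iff
      -- Evaluation at `()` identifies the range of the row `A` with `J`, giving `0 → J → R → R/J →
      -- 0`; this accounts for one more step.
      (f := LinearMap.proj () ∘ₗ (LinearMap.range A.mulVecLin).subtype) (g := J.mkQ) ?_ ?_
      J.mkQ_surjective
    · intro x y hxy
      exact Subtype.ext (funext fun i => hxy)
    · intro y
      rw [Submodule.mkQ_apply, Submodule.Quotient.mk_eq_zero, hJ]
      constructor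
      · rintro ⟨v, hv⟩
        exact ⟨⟨_, v, hv⟩, rfl⟩
      · rintro ⟨⟨_, v, rfl⟩, rfl⟩
        exact ⟨v, rfl⟩
  refine le_antisymm ?_ ?_
  · rw [pdimQuotient, projectiveDimension_le_iff]
    exact (hiff (n + 1)).2 hL.hasProjectiveDimensionLE
  · rw [pdimQuotient, projectiveDimension_ge_iff, hiff]
    exact hL.not_hasProjectiveDimensionLT

end ProjectiveDimension

end BarbellCounterexample
namespace BarbellCounterexample

open MvPolynomial Matrix

/-! ### Linear quotients for ideals of variables and for Ferrers graphs. -/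

section LinearQuotients

universe u

variable (K : Type u) [Field K]

/-- The ideal generated by the variables in `S`. -/
noncomputable def varIdeal {σ : Type} (S : Finset σ) : Ideal (MvPolynomial σ K) :=
  Ideal.span (X '' (S : Set σ))

theorem mul_X_mem_varIdeal {σ : Type} {S : Finset σ} {i : σ} (hi : i ∉ S)
    (h : MvPolynomial σ K) : h * X i ∈ varIdeal K S ↔ h ∈ varIdeal K S := by
  classical
  refine ⟨fun hh => ?_, fun hh => Ideal.mul_mem_right _ _ hh⟩
  rw [varIdeal, mem_ideal_span_X_image] at hh ⊢
  intro m hm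
  obtain ⟨j, hj, hmj⟩ := hh (m + Finsupp.single i 1) (by
    rw [mem_support_iff, coeff_mul_X]
    exact mem_support_iff.1 hm)
  refine ⟨j, hj, ?_⟩
  have hij : i ≠ j := by
    rintro rfl
    exact hi hj
  simpa [Finsupp.single_apply, hij] using hmj

theorem hasLinRes_varIdeal {σ : Type} {S : Finset σ} (hS : S.Nonempty) :
    HasLinRes True (S.card - 1) 1 (varIdeal K S) := by
  classical
  induction hS using Finset.Nonempty.cons_induction with
  | singleton i =>
    rw [varIdeal, Finset.coe_singleton, Set.image_singleton]
    exact hasLinRes_span_singleton (X_ne_zero i) (isHomogeneous_X K i)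
  | cons i S hi hS ih =>
    have hcard : S.card - 1 + 1 = S.card := Nat.sub_add_cancel hS.card_pos
    rw [varIdeal, Finset.coe_cons, Set.image_insert_eq, Ideal.span_insert, sup_comm,
      Finset.card_cons, Nat.add_sub_cancel, ← hcard]
    -- The new variable is a nonzerodivisor modulo the old ones, so the colon ideal is again
    -- `varIdeal K S`, as in the Koszul complex. The nonzero last module comes from the colon side.
    exact ((ih.of_le (Nat.le_succ _)).sup_span_singleton (isHomogeneous_X K i)
      (mul_X_mem_varIdeal K hi) ih).weaken Or.inr

theorem hasLinRes_varIdeal_of_card_le {σ : Type} {S : Finset σ} {m : ℕ} (hS : S.card ≤ m + 1) :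
    HasLinRes False m 1 (varIdeal K S) := by
  rcases S.eq_empty_or_nonempty with rfl | hne
  · rw [varIdeal, Finset.coe_empty, Set.image_empty, Ideal.span_empty]
    exact hasLinRes_bot m 1
  · exact (hasLinRes_varIdeal K hne).of_le (by omega)

variable {α β : Type}

/-- The edge ideal of the bipartite graph with edge set `T`. -/
noncomputable def pairIdeal (T : Finset (α × β)) : Ideal (MvPolynomial (α ⊕ β) K) :=
  Ideal.span ((fun p : α × β => X (Sum.inl p.1) * X (Sum.inr p.2)) '' (T : Set (α × β)))

theorem pairIdeal_insert [DecidableEq α] [DecidableEq β] (T : Finset (α × β)) (p : α × β) :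
    pairIdeal K (insert p T) =
      pairIdeal K T ⊔ Ideal.span {X (Sum.inl p.1) * X (Sum.inr p.2)} := by
  rw [pairIdeal, Finset.coe_insert, Set.image_insert_eq, Ideal.span_insert, sup_comm, pairIdeal]

variable [Fintype β] [DecidableEq α] [DecidableEq β]

/-- The edges of the Ferrers graph with full rows `A` and a row `i` with entries `B`. -/
def ferrersEdges (A : Finset α) (i : α) (B : Finset β) : Finset (α × β) :=
  A ×ˢ Finset.univ ∪ {i} ×ˢ B

theorem mem_ferrersEdges {A : Finset α} {i : α} {B : Finset β} {p : α × β} :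
    p ∈ ferrersEdges A i B ↔ p.1 ∈ A ∨ p.1 = i ∧ p.2 ∈ B := by
  rcases p with ⟨k, l⟩
  simp [ferrersEdges, and_comm, eq_comm]

theorem ferrersEdges_insert (A : Finset α) (i : α) (B : Finset β) (j : β) :
    ferrersEdges A i (insert j B) = insert (i, j) (ferrersEdges A i B) := by
  ext ⟨k, l⟩
  simp only [Finset.mem_insert, mem_ferrersEdges, Prod.mk.injEq]
  tauto

/-- For `k ∈ A` the full row `k` contains `x_k y_j`, so `x_k` lies in the colon ideal; for `l ∈ B`,
so does `y_l`, through `x_i y_l`. Conversely, if `x_k y_l` divides a monomial times `x_i y_j`, then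
either `k ≠ i` and `x_k` divides the monomial, or `k = i`, `l ≠ j` and `y_l` does. -/
theorem mul_mem_pairIdeal_ferrersEdges {A : Finset α} {i : α} (hi : i ∉ A) {B : Finset β} {j : β}
    (hj : j ∉ B) (h : MvPolynomial (α ⊕ β) K) :
    h * (X (Sum.inl i) * X (Sum.inr j)) ∈ pairIdeal K (ferrersEdges A i B) ↔
      h ∈ varIdeal K (A.disjSum B) := by
  constructor
  · intro hh
    have himage : (fun p : α × β => (X (Sum.inl p.1) * X (Sum.inr p.2) : MvPolynomial (α ⊕ β) K)) =
        (fun s => monomial s 1) ∘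
          fun p => Finsupp.single (Sum.inl p.1) 1 + Finsupp.single (Sum.inr p.2) 1 := by
      funext p
      simp [X, monomial_mul]
    rw [pairIdeal, himage, Set.image_comp, mem_ideal_span_monomial_image] at hh
    rw [varIdeal, mem_ideal_span_X_image]
    intro m hm
    obtain ⟨_, ⟨⟨k, l⟩, hkl, rfl⟩, hle⟩ :=
      hh (m + Finsupp.single (Sum.inl i) 1 + Finsupp.single (Sum.inr j) 1) (by
        rw [mem_support_iff, ← mul_assoc, coeff_mul_X, coeff_mul_X]
        exact mem_support_iff.1 hm)
    rcases mem_ferrersEdges.1 hkl with hk | ⟨rfl, hl⟩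
    · have hik : i ≠ k := by
        rintro rfl
        exact hi hk
      refine ⟨Sum.inl k, by simpa using hk, ?_⟩
      have := hle (Sum.inl k)
      simp [hik] at this
      omega
    · have hjl : j ≠ l := by
        rintro rfl
        exact hj hl
      refine ⟨Sum.inr l, by simpa using hl, ?_⟩
      have := hle (Sum.inr l)
      simp [hjl] at this
      omega
  · intro hh
    have hle : varIdeal K (A.disjSum B) ≤ Submodule.comap
        (LinearMap.mulRight (MvPolynomial (α ⊕ β) K) (X (Sum.inl i) * X (Sum.inr j)))
        (pairIdeal K (ferrersEdges A i B)) := by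
      refine Ideal.span_le.2 ?_
      rintro _ ⟨v, hv, rfl⟩
      have hgen : ∀ p ∈ ferrersEdges A i B,
          (X (Sum.inl p.1) * X (Sum.inr p.2) : MvPolynomial (α ⊕ β) K) ∈
            pairIdeal K (ferrersEdges A i B) :=
        fun p hp => Ideal.subset_span ⟨p, hp, rfl⟩
      change X v * (X (Sum.inl i) * X (Sum.inr j)) ∈ pairIdeal K (ferrersEdges A i B)
      rcases Finset.mem_disjSum.1 hv with ⟨k, hk, rfl⟩ | ⟨l, hl, rfl⟩
      · have := Ideal.mul_mem_left _ (X (Sum.inl i)) (hgen (k, j) (mem_ferrersEdges.2 (Or.inl hk)))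
        convert this using 1
        ring
      · have := Ideal.mul_mem_left _ (X (Sum.inr j))
          (hgen (i, l) (mem_ferrersEdges.2 (Or.inr ⟨rfl, hl⟩)))
        convert this using 1
        ring
    exact hle hh

theorem hasLinRes_pairIdeal_insert {t t' : Prop} {A : Finset α} {i : α} (hi : i ∉ A)
    {B : Finset β} {j : β} (hj : j ∉ B) {m : ℕ}
    (h : HasLinRes t (m + 1) 2 (pairIdeal K (ferrersEdges A i B)))
    (h' : HasLinRes t' m 1 (varIdeal K (A.disjSum B))) :
    HasLinRes (t ∨ t') (m + 1) 2 (pairIdeal K (ferrersEdges A i (insert j B))) := by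
  rw [ferrersEdges_insert, pairIdeal_insert]
  exact h.sup_span_singleton ((isHomogeneous_X K _).mul (isHomogeneous_X K _))
    (mul_mem_pairIdeal_ferrersEdges K hi hj) h'

/-- The bound counts the finished row: its last entry has a colon ideal on at most `m + 1`
variables, resolved in length `m`. -/
theorem hasLinRes_pairIdeal_row {A : Finset α} {i : α} (hi : i ∉ A) {m : ℕ}
    (h : HasLinRes False (m + 1) 2 (pairIdeal K (A ×ˢ (Finset.univ : Finset β))))
    {B : Finset β} (hB : A.card + B.card ≤ m + 2) :
    HasLinRes False (m + 1) 2 (pairIdeal K (ferrersEdges A i B)) := by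
  induction B using Finset.induction_on with
  | empty => simpa [ferrersEdges] using h
  | insert j B hj ih =>
    rw [Finset.card_insert_of_notMem hj] at hB
    exact (hasLinRes_pairIdeal_insert K hi hj (ih (by omega))
      (hasLinRes_varIdeal_of_card_le K (by rw [Finset.card_disjSum]; omega))).weaken False.elim

theorem hasLinRes_pairIdeal_rows {A : Finset α} {m : ℕ}
    (hA : A.card + Fintype.card β ≤ m + 3) :
    HasLinRes False (m + 1) 2 (pairIdeal K (A ×ˢ (Finset.univ : Finset β))) := by
  induction A using Finset.induction_on with
  | empty =>
    rw [Finset.empty_product, pairIdeal, Finset.coe_empty, Set.image_empty, Ideal.span_empty]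
    exact hasLinRes_bot _ _
  | insert i A hi ih =>
    rw [Finset.card_insert_of_notMem hi] at hA
    have h := hasLinRes_pairIdeal_row K hi (ih (by omega)) (B := Finset.univ)
      (by rw [Finset.card_univ]; omega)
    convert h using 2
    ext ⟨k, l⟩
    simp [mem_ferrersEdges, or_comm]

/-- Only the last edge matters for sharpness: its colon ideal has exactly `m + 1` variables, so its
resolution ends in a nonzero module at step `m`. -/
theorem hasLinRes_pairIdeal_ferrersEdges {A : Finset α} {i : α} (hi : i ∉ A) {B : Finset β}
    (hB : B.Nonempty) {m : ℕ} (hA : A.card + Fintype.card β ≤ m + 3)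
    (hAB : A.card + B.card = m + 2) :
    HasLinRes True (m + 1) 2 (pairIdeal K (ferrersEdges A i B)) := by
  obtain ⟨j, hj⟩ := hB
  have hcard := Finset.card_erase_add_one hj
  have hS : (A.disjSum (B.erase j)).card = m + 1 := by
    rw [Finset.card_disjSum]
    omega
  have h := hasLinRes_varIdeal K (Finset.card_pos.1 (by rw [hS]; omega))
  rw [hS, Nat.add_sub_cancel] at h
  rw [← Finset.insert_erase hj]
  exact (hasLinRes_pairIdeal_insert K hi (Finset.notMem_erase j B)
    (hasLinRes_pairIdeal_row K hi (hasLinRes_pairIdeal_rows K hA) (by omega)) h).weaken Or.inr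

end LinearQuotients

end BarbellCounterexample
namespace BarbellCounterexample

open MvPolynomial

/-! ### The barbell graph and its complement. -/

section Barbell

theorem cycleGraph_adj_iff {k : ℕ} {u v : Fin k} (huv : u < v) :
    (SimpleGraph.cycleGraph k).Adj u v ↔ v.val = u.val + 1 ∨ v.val + 1 = k + u.val := by
  have h1 := Fin.coe_sub_iff_lt.2 huv
  have h2 := Fin.sub_val_of_le huv.le
  rw [SimpleGraph.cycleGraph_adj', h1, h2]
  have := v.isLt
  have := Fin.lt_def.1 huv
  omega

variable {r : ℕ} (a b : Fin r)

theorem barbell_adj_inl_inl (i j : Fin r) :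
    (barbell a b).Adj (Sum.inl i) (Sum.inl j) ↔ i ≠ j := by
  simp [barbell, SimpleGraph.edge_adj]

theorem barbell_adj_inr_inr (i j : Fin r) :
    (barbell a b).Adj (Sum.inr i) (Sum.inr j) ↔ i ≠ j := by
  simp [barbell, SimpleGraph.edge_adj]

theorem barbell_adj_inl_inr (i j : Fin r) :
    (barbell a b).Adj (Sum.inl i) (Sum.inr j) ↔ i = a ∧ j = b := by
  simp [barbell, SimpleGraph.edge_adj, eq_comm]

theorem barbell_adj_inr_inl (i j : Fin r) :
    (barbell a b).Adj (Sum.inr j) (Sum.inl i) ↔ i = a ∧ j = b := by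
  rw [SimpleGraph.adj_comm, barbell_adj_inl_inr]

/-- Along an induced cycle, vertices two steps apart are distinct and nonadjacent, hence in
different cliques. So exactly one of any two consecutive edges is the bridge. Among four consecutive
edges the bridge then occurs twice with one edge between, and that edge, lying in one clique, would
have equal endpoints. -/
theorem isChordal_barbell : IsChordal (barbell a b) := by
  rintro k hk ⟨φ⟩
  have hφ : ∀ u v, (barbell a b).Adj (φ u) (φ v) ↔ (SimpleGraph.cycleGraph k).Adj u v :=
    fun u v => φ.map_rel_iff
  let v0 : Fin k := ⟨0, by omega⟩
  let v1 : Fin k := ⟨1, by omega⟩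
  let v2 : Fin k := ⟨2, by omega⟩
  let v3 : Fin k := ⟨3, by omega⟩
  -- The fifth vertex supplies the fourth edge; in the 4-cycle it is `v0` again.
  obtain ⟨v4, h34, h24⟩ : ∃ v4 : Fin k, (SimpleGraph.cycleGraph k).Adj v3 v4 ∧
      ¬ (SimpleGraph.cycleGraph k).Adj v2 v4 ∧ v2 ≠ v4 := by
    rcases hk.eq_or_lt with rfl | hk
    · refine ⟨v0, ?_, ?_, ?_⟩ <;> decide +revert
    · have h23 : v2 < ⟨4, hk⟩ := by simp [v2]
      have h34 : v3 < ⟨4, hk⟩ := by simp [v3]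
      refine ⟨⟨4, hk⟩, (cycleGraph_adj_iff h34).2 (by simp [v3]), ?_, h23.ne⟩
      rw [cycleGraph_adj_iff h23]
      simp [v2]
      omega
  have hlt01 : v0 < v1 := by simp [v0, v1]
  have hlt12 : v1 < v2 := by simp [v1, v2]
  have hlt23 : v2 < v3 := by simp [v2, v3]
  have e01 := (hφ v0 v1).2 ((cycleGraph_adj_iff hlt01).2 (by simp [v0, v1]))
  have e12 := (hφ v1 v2).2 ((cycleGraph_adj_iff hlt12).2 (by simp [v1, v2]))
  have e23 := (hφ v2 v3).2 ((cycleGraph_adj_iff hlt23).2 (by simp [v2, v3]))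
  have e34 := (hφ v3 v4).2 h34
  have n02 : ¬ (barbell a b).Adj (φ v0) (φ v2) := by
    rw [hφ, cycleGraph_adj_iff (hlt01.trans hlt12)]
    simp [v0, v2]
    omega
  have n13 : ¬ (barbell a b).Adj (φ v1) (φ v3) := by
    rw [hφ, cycleGraph_adj_iff (hlt12.trans hlt23)]
    simp [v1, v3]
    omega
  have n24 : ¬ (barbell a b).Adj (φ v2) (φ v4) := by
    rw [hφ]
    exact h24.1
  have d02 := φ.injective.ne (hlt01.trans hlt12).ne
  have d13 := φ.injective.ne (hlt12.trans hlt23).ne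
  have d24 := φ.injective.ne h24.2
  generalize φ v0 = w0 at *
  generalize φ v1 = w1 at *
  generalize φ v2 = w2 at *
  generalize φ v3 = w3 at *
  generalize φ v4 = w4 at *
  rcases w0 with w0 | w0 <;> rcases w1 with w1 | w1 <;> rcases w2 with w2 | w2 <;>
  rcases w3 with w3 | w3 <;> rcases w4 with w4 | w4 <;>
  simp only [barbell_adj_inl_inl, barbell_adj_inr_inr, barbell_adj_inl_inr, barbell_adj_inr_inl,
    ne_eq, Sum.inl.injEq, Sum.inr.injEq] at * <;> grind

theorem compl_barbell_adj_inl_inr (i j : Fin r) :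
    (barbell a b)ᶜ.Adj (Sum.inl i) (Sum.inr j) ↔ ¬ (i = a ∧ j = b) := by
  simp [SimpleGraph.compl_adj, barbell_adj_inl_inr]

theorem not_compl_barbell_adj_inl_inl (i j : Fin r) :
    ¬ (barbell a b)ᶜ.Adj (Sum.inl i) (Sum.inl j) := by
  simp [SimpleGraph.compl_adj, barbell_adj_inl_inl]

theorem not_compl_barbell_adj_inr_inr (i j : Fin r) :
    ¬ (barbell a b)ᶜ.Adj (Sum.inr i) (Sum.inr j) := by
  simp [SimpleGraph.compl_adj, barbell_adj_inr_inr]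

theorem isCoChordal_compl_barbell : IsCoChordal (barbell a b)ᶜ := by
  rw [IsCoChordal, compl_compl]
  exact isChordal_barbell a b

theorem connected_compl_barbell (hr : 2 ≤ r) : (barbell a b)ᶜ.Connected := by
  have : Nontrivial (Fin r) := Fin.nontrivial_iff_two_le.2 hr
  obtain ⟨a', ha⟩ := exists_ne a
  obtain ⟨b', hb⟩ := exists_ne b
  have hr : ∀ j, (barbell a b)ᶜ.Reachable (Sum.inl a') (Sum.inr j) := fun j =>
    ((compl_barbell_adj_inl_inr a b a' j).2 fun h => ha h.1).reachable
  refine SimpleGraph.connected_iff_exists_forall_reachable _ |>.2 ⟨Sum.inl a', ?_⟩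
  rintro (i | j)
  · exact (hr b').trans ((compl_barbell_adj_inl_inr a b i b').2 fun h => hb h.2).reachable.symm
  · exact hr j

theorem maxDeg_compl_barbell (hr : 2 ≤ r) : maxDeg (barbell a b)ᶜ = r := by
  classical
  have : Nontrivial (Fin r) := Fin.nontrivial_iff_two_le.2 hr
  obtain ⟨a', ha⟩ := exists_ne a
  have hll := not_compl_barbell_adj_inl_inl a b
  have hrr := not_compl_barbell_adj_inr_inr a b
  have hlr := fun j => (compl_barbell_adj_inl_inr a b a' j).2 fun h => ha h.1
  generalize (barbell a b)ᶜ = G at *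
  rw [maxDeg]
  apply le_antisymm
  · apply SimpleGraph.maxDegree_le_of_forall_degree_le
    rintro (i | j)
    · calc _ ≤ (Finset.univ.map (Function.Embedding.inr : Fin r ↪ Fin r ⊕ Fin r)).card := by
            refine Finset.card_le_card ?_
            rintro (k | k) hk
            · exact absurd ((SimpleGraph.mem_neighborFinset _ _ _).1 hk) (hll i k)
            · simp
        _ = r := by simp
    · calc _ ≤ (Finset.univ.map (Function.Embedding.inl : Fin r ↪ Fin r ⊕ Fin r)).card := by
            refine Finset.card_le_card ?_
            rintro (k | k) hk
            · simp
            · exact absurd ((SimpleGraph.mem_neighborFinset _ _ _).1 hk) (hrr j k)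
        _ = r := by simp
  · refine le_trans ?_ (SimpleGraph.degree_le_maxDegree _ (Sum.inl a'))
    calc r = (Finset.univ.map (Function.Embedding.inr : Fin r ↪ Fin r ⊕ Fin r)).card := by simp
      _ ≤ _ := by
        refine Finset.card_le_card ?_
        intro v hv
        obtain ⟨j, -, rfl⟩ := Finset.mem_map.1 hv
        exact (SimpleGraph.mem_neighborFinset _ _ _).2 (hlr j)

universe u

variable (K : Type u) [Field K]

/-- Complementing turns the two cliques into independent sides and the bridge into the only missing
edge between them. -/
theorem edgeIdeal_compl_barbell : edgeIdeal K (barbell a b)ᶜ =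
    pairIdeal K (ferrersEdges (Finset.univ.erase a) a (Finset.univ.erase b)) := by
  have hmem : ∀ i j, (i, j) ∈ ferrersEdges (Finset.univ.erase a) a (Finset.univ.erase b) ↔
      (barbell a b)ᶜ.Adj (Sum.inl i) (Sum.inr j) := by
    intro i j
    rw [mem_ferrersEdges, compl_barbell_adj_inl_inr]
    simp only [Finset.mem_erase, Finset.mem_univ, and_true]
    tauto
  apply le_antisymm
  · refine Ideal.span_le.2 ?_
    rintro _ ⟨u | u, v | v, huv, rfl⟩
    · exact absurd huv (not_compl_barbell_adj_inl_inl a b u v)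
    · exact Ideal.subset_span ⟨(u, v), (hmem u v).2 huv, rfl⟩
    · exact Ideal.subset_span ⟨(v, u), (hmem v u).2 huv.symm, mul_comm _ _⟩
    · exact absurd huv (not_compl_barbell_adj_inr_inr a b u v)
  · refine Ideal.span_le.2 ?_
    rintro _ ⟨⟨i, j⟩, hij, rfl⟩
    exact Ideal.subset_span ⟨_, _, (hmem i j).1 hij, rfl⟩

theorem hasLinRes_edgeIdeal_compl_barbell (hr : 2 ≤ r) :
    HasLinRes True (2 * r - 4 + 1) 2 (edgeIdeal K (barbell a b)ᶜ) := by
  have : Nontrivial (Fin r) := Fin.nontrivial_iff_two_le.2 hr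
  obtain ⟨b', hb⟩ := exists_ne b
  rw [edgeIdeal_compl_barbell]
  apply hasLinRes_pairIdeal_ferrersEdges K (Finset.notMem_erase _ _) ⟨b', by simp [hb]⟩
  · rw [Finset.card_erase_of_mem (Finset.mem_univ _), Finset.card_univ, Fintype.card_fin]
    omega
  · rw [Finset.card_erase_of_mem (Finset.mem_univ _), Finset.card_erase_of_mem (Finset.mem_univ _),
      Finset.card_univ, Fintype.card_fin]
    omega

theorem pdimQuotient_edgeIdeal_compl_barbell (hr : 2 ≤ r) :
    pdimQuotient K (edgeIdeal K (barbell a b)ᶜ) = ((2 * r - 2 : ℕ) : WithBot ℕ∞) := by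
  rw [(hasLinRes_edgeIdeal_compl_barbell a b K hr).pdimQuotient_eq]
  congr 2
  omega

theorem pdimStanleyReisner_compl_barbell (hr : 2 ≤ r) :
    pdimStanleyReisner K (independenceComplex (barbell a b)ᶜ) =
      ((2 * r - 2 : ℕ) : WithBot ℕ∞) := by
  rw [pdimStanleyReisner, stanleyReisnerIdeal_independenceComplex,
    pdimQuotient_edgeIdeal_compl_barbell a b K hr]

end Barbell

end BarbellCounterexample

/-! ### The counterexamples and the unbounded gap. -/

theorem mainTheorem5 (K : Type*) [Field K] :
    (∀ (r : ℕ), 3 ≤ r → ∀ (a b : Fin r) (G : SimpleGraph (Fin r ⊕ Fin r)),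
      G = (BarbellCounterexample.barbell a b)ᶜ →
        G.Connected ∧
        BarbellCounterexample.IsCoChordal G ∧
        BarbellCounterexample.HasTwoLinearResolution (BarbellCounterexample.edgeIdeal K G) ∧
        BarbellCounterexample.maxDeg G = r ∧
        BarbellCounterexample.pdimStanleyReisner K
            (BarbellCounterexample.independenceComplex G) = ((2 * r - 2 : ℕ) : WithBot ℕ∞) ∧
        BarbellCounterexample.pdimStanleyReisner K
            (BarbellCounterexample.independenceComplex G) =
          ((BarbellCounterexample.maxDeg G + (r - 2) : ℕ) : WithBot ℕ∞)) ∧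
    (∀ N : ℕ, ∃ (V : Type) (_ : Fintype V) (G : SimpleGraph V) (p : ℕ),
      G.Connected ∧
      BarbellCounterexample.IsCoChordal G ∧
      BarbellCounterexample.HasTwoLinearResolution (BarbellCounterexample.edgeIdeal K G) ∧
      BarbellCounterexample.pdimStanleyReisner K
          (BarbellCounterexample.independenceComplex G) = (p : WithBot ℕ∞) ∧
      BarbellCounterexample.maxDeg G + N ≤ p) ∧
    ¬ BarbellCounterexample.EliahouVillarrealConjecture K ∧
    ¬ BarbellCounterexample.EliahouVillarrealConjectureCoChordal K := by
  refine ⟨?_, ?_, ?_, ?_⟩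
  · rintro r hr a b _ rfl
    have hr2 : 2 ≤ r := by omega
    refine ⟨BarbellCounterexample.connected_compl_barbell a b hr2, BarbellCounterexample.isCoChordal_compl_barbell a b,
      (BarbellCounterexample.hasLinRes_edgeIdeal_compl_barbell a b K hr2).hasTwoLinearResolution,
      BarbellCounterexample.maxDeg_compl_barbell a b hr2, BarbellCounterexample.pdimStanleyReisner_compl_barbell a b K hr2, ?_⟩
    rw [BarbellCounterexample.pdimStanleyReisner_compl_barbell a b K hr2, BarbellCounterexample.maxDeg_compl_barbell a b hr2]
    congr 2
    omega
  · intro N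
    -- Taking `r = N + 2` makes the gap `r - 2` equal to `N`; the formulas already hold for `r = 2`.
    have hr2 : 2 ≤ N + 2 := by omega
    refine ⟨Fin (N + 2) ⊕ Fin (N + 2), inferInstance, (BarbellCounterexample.barbell 0 0)ᶜ, 2 * (N + 2) - 2,
      BarbellCounterexample.connected_compl_barbell 0 0 hr2, BarbellCounterexample.isCoChordal_compl_barbell 0 0,
      (BarbellCounterexample.hasLinRes_edgeIdeal_compl_barbell 0 0 K hr2).hasTwoLinearResolution,
      BarbellCounterexample.pdimStanleyReisner_compl_barbell 0 0 K hr2, ?_⟩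
    rw [BarbellCounterexample.maxDeg_compl_barbell 0 0 hr2]
    omega
  · intro h
    have hr2 : 2 ≤ 3 := by omega
    have h3 := h _ (BarbellCounterexample.barbell (0 : Fin 3) 0)ᶜ (BarbellCounterexample.connected_compl_barbell 0 0 hr2)
      (BarbellCounterexample.hasLinRes_edgeIdeal_compl_barbell 0 0 K hr2).hasTwoLinearResolution
    rw [BarbellCounterexample.pdimQuotient_edgeIdeal_compl_barbell 0 0 K hr2, BarbellCounterexample.maxDeg_compl_barbell 0 0 hr2] at h3
    -- For `r = 3` the projective dimension is 4 and the maximum degree is 3.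
    exact absurd h3 (by norm_cast)
  · intro h
    have hr2 : 2 ≤ 3 := by omega
    have h3 := h _ (BarbellCounterexample.barbell (0 : Fin 3) 0)ᶜ (BarbellCounterexample.connected_compl_barbell 0 0 hr2)
      (BarbellCounterexample.isCoChordal_compl_barbell 0 0)
    rw [BarbellCounterexample.pdimStanleyReisner_compl_barbell 0 0 K hr2, BarbellCounterexample.maxDeg_compl_barbell 0 0 hr2] at h3
    exact absurd h3 (by norm_cast)
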